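/- Consider $n$ synchronous agents, each with an initial value in $\{0,1\}$, of whom at most $t<n$ may crash: an agent that crashes in a round delivers an arbitrary subset of its messages of that round and sends nothing and does not run the protocol afterwards. In the \emph{Vectorized FloodSet} exchange, agent $i$ keeps a vector $V_i$ of initial values, indexed by the agents (with $\bot$ for unknown entries; initially only its own entry is known), and a set $New_i$ of pairs (value, agent) (initially its own value). In each round it sends $New_i$, if nonempty, to every other agent; it then fills in the $\bot$ entries of $V_i$ that the received messages determine, and lets $New_i$ be the set of pairs that were newly filled in. Its local state at time $m$ (after $m$ rounds) is $(V_i,New_i,m)$, or $\mathit{crashed}$. Let $\mathcal I$ be the system of all runs, one for each choice of initial values and failure pattern; two points are indistinguishable to $i$ if $i$ has the same local state at both. Let $\mathcal N$ be the indexical set of nonfailed agents, let $C_{\mathcal N}$ be the corresponding common knowledge operator, let $\exists v$ be the proposition that some agent has initial value $v$, and let $\beta_i(r,m)$ be the number of $\bot$ entries of $V_i$ at the point $(r,m)$. \textbf{Theorem.} (1) Let $r$ be a run, $m$ a time and $i\in\mathcal N(r,m)$; if $t+2<n$, suppose that $m\ge 1$. Then $$(\mathcal I,r,m)\models C_{\mathcal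 N}(\exists 0)\lor C_{\mathcal N}(\exists 1)\quad\Longleftrightarrow\quad m>\min\{t+1,n-1\}-\max\{1,\beta_i(r,m)\}.$$ (2) Consider the rule by which agent $i$ decides at time $m$ if this inequality holds (and $m\ge1$ in case $t+2<n$), on $0$ if $0$ occurs in $V_i$ and on $1$ otherwise. It solves Simultaneous Byzantine Agreement, that is: any two decisions of nonfailed agents in a run are equal; a value decided is some agent's initial value; and if a nonfailed agent decides in a round, then all nonfailed agents decide in that round. It is an optimum such protocol for this exchange: at every point at which some decision protocol satisfying these conditions makes a nonfailed agent decide, this rule also makes it decide. (3) With this rule, every agent that is nonfailed at time $t+1$ has decided by time $t+1$; and if $t\ge 2$ or $n=t+1$, there is a run in which a nonfailed agent decides at some time before $t+1$. -/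

import Mathlib

namespace VecFloodSet

/-- Initial preferences / decision values. -/
abbrev Value := Fin 2

/-- A set of pairs (v, k), each saying that agent k has initial value v.  This is the type of
the messages and of the `New` component of the local states. -/
abbrev Info (n : ℕ) := Finset (Value × Fin n)

/-- Local states: the state of a crashed agent, or the value vector (`none` is the unknown
entry ⊥), the set of pairs first learned in the latest round, and the clock. -/
inductive LocalState (n : ℕ) where
  | crashed : LocalState n
  | active (V : Fin n → Option Value) (New : Info n) (time : ℕ) : LocalState n

inductive Action where
  | decide (v : Value) : Action
  | noop : Action

/-! ### The crash failure model

`F m i j = false` means that the message (if any) from `i` to `j` in round `m + 1`, i.e. between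
times `m` and `m + 1`, is not delivered; `F m i i = false` means that `i` crashes in that round
or has crashed before. -/

structure IsCrashAdversary (n t : ℕ) (F : ℕ → Fin n → Fin n → Bool) : Prop where
  /-- an agent that loses a message crashes in that round (or has crashed before) -/
  crash_of_lost : ∀ m i j, F m i j = false → F m i i = false
  /-- an agent sends nothing in the rounds after its crash -/
  silent_after : ∀ m i, F m i i = false → ∀ m', m < m' → ∀ j, F m' i j = false
  /-- at most `t` agents are faulty -/
  card_faulty : {i : Fin n | ∃ m j, F m i j = false}.ncard ≤ t

/-! ### The information exchange

Neither the messages nor the state updates depend on the actions of the agents, so that the runs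
of the exchange are the same for all decision protocols. -/

def initState {n : ℕ} (i : Fin n) (v : Value) : LocalState n :=
  .active (fun k => if k = i then some v else none) {(v, i)} 0

/-- The message that `i`, in state `s`, sends to `j`: its new information, if there is any. -/
def message {n : ℕ} (i : Fin n) (s : LocalState n) (j : Fin n) : Option (Info n) :=
  match s with
  | .crashed => none
  | .active _ New _ => if New ≠ ∅ ∧ j ≠ i then some New else none

/-- All the pairs in the messages received (no message counts as the empty message). -/
def received {n : ℕ} (msgs : Fin n → Option (Info n)) : Info n :=
  Finset.univ.biUnion fun j => (msgs j).getD ∅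

/-- The value vector after filling in unknown entries.  (Pairs that occur in runs carry actual
initial values, so that there is never a conflict and the order of processing is irrelevant.) -/
def updateVec {n : ℕ} (V : Fin n → Option Value) (W : Info n) : Fin n → Option Value :=
  fun k =>
    if V k = none then
      if (0, k) ∈ W then some 0 else if (1, k) ∈ W then some 1 else none
    else V k

/-- The pairs that were filled in. -/
def newInfo {n : ℕ} (V V' : Fin n → Option Value) : Info n :=
  Finset.univ.filter fun p => V p.2 = none ∧ V' p.2 = some p.1

/-- State update of agent `i` in environment state `F` upon receiving `msgs`. -/
def transition {n : ℕ} (F : ℕ → Fin n → Fin n → Bool) (i : Fin n) (s : LocalState n)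
    (msgs : Fin n → Option (Info n)) : LocalState n :=
  match s with
  | .crashed => .crashed
  | .active V _ m =>
      if F m i i = false then .crashed
      else .active (updateVec V (received msgs))
        (newInfo V (updateVec V (received msgs))) (m + 1)

/-- A run is determined by the adversary and the initial values. -/
structure Run (n t : ℕ) where
  F : ℕ → Fin n → Fin n → Bool
  isCrash : IsCrashAdversary n t F
  init : Fin n → Value

/-- The local states of the agents at each time of a run. -/
def Run.state {n t : ℕ} (r : Run n t) : ℕ → Fin n → LocalState n
  | 0 => fun i => initState i (r.init i)
  | m + 1 => fun i => transition r.F i (r.state m i)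
      fun j => if r.F m j i = true then message j (r.state m j) i else none

/-- The agent `i` belongs to the set 𝒩(r, m) of nonfailed agents. -/
def Run.Nonfailed {n t : ℕ} (r : Run n t) (m : ℕ) (i : Fin n) : Prop :=
  r.state m i ≠ .crashed

/-- The number of ⊥ entries in the value vector. -/
def unknowns {n : ℕ} : LocalState n → ℕ
  | .crashed => 0
  | .active V _ _ => (Finset.univ.filter fun k => V k = none).card

/-- `β_i(r, m)` -/
def Run.beta {n t : ℕ} (r : Run n t) (m : ℕ) (i : Fin n) : ℕ := unknowns (r.state m i)

/-! ### Knowledge -/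

abbrev Point (n t : ℕ) := Run n t × ℕ

/-- Formulas, identified with their sets of points. -/
abbrev Formula (n t : ℕ) := Point n t → Prop

def Indist {n t : ℕ} (i : Fin n) (p q : Point n t) : Prop :=
  p.1.state p.2 i = q.1.state q.2 i

/-- `K_i φ` -/
def K {n t : ℕ} (i : Fin n) (φ : Formula n t) : Formula n t :=
  fun p => ∀ q, Indist i p q → φ q

/-- `E_𝒩 φ` -/
def E {n t : ℕ} (φ : Formula n t) : Formula n t :=
  fun p => ∀ i, p.1.Nonfailed p.2 i → K i φ p

/-- `C_𝒩 φ` -/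
def C {n t : ℕ} (φ : Formula n t) : Formula n t :=
  fun p => ∀ k : ℕ, 1 ≤ k → (E^[k]) φ p

/-- `∃v`: some agent has initial value `v`. -/
def existsValue {n t : ℕ} (v : Value) : Formula n t :=
  fun p => ∃ i, p.1.init i = v

/-! ### Decision protocols -/

abbrev DecisionProtocol (n : ℕ) := Fin n → LocalState n → Action

/-- `P` makes nonfailed `i` decide `v` at time `m` of `r` (i.e. in round `m + 1`). -/
def Decides {n t : ℕ} (P : DecisionProtocol n) (r : Run n t) (m : ℕ) (i : Fin n)
    (v : Value) : Prop :=
  r.Nonfailed m i ∧ P i (r.state m i) = .decide v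

/-- Simultaneous Byzantine Agreement (termination is stated separately, so that optimality below
is relative to the larger class of protocols). -/
structure IsSBA {n : ℕ} (t : ℕ) (P : DecisionProtocol n) : Prop where
  agreement : ∀ (r : Run n t) m m' i j v v', Decides P r m i v → Decides P r m' j v' → v = v'
  validity : ∀ (r : Run n t) m i v, Decides P r m i v → ∃ j, r.init j = v
  simultaneity : ∀ (r : Run n t) m i v, Decides P r m i v →
    ∀ j, r.Nonfailed m j → ∃ w, Decides P r m j w

/-- `P ≤ Q`: whenever `P` decides, so does `Q` in the corresponding run. -/
def DecidesNoEarlier {n : ℕ} (t : ℕ) (P Q : DecisionProtocol n) : Prop :=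
  ∀ (r : Run n t) m i v, Decides P r m i v → ∃ w, Decides Q r m i w

def IsOptimumSBA {n : ℕ} (t : ℕ) (P : DecisionProtocol n) : Prop :=
  IsSBA t P ∧ ∀ P' : DecisionProtocol n, IsSBA t P' → DecidesNoEarlier t P' P

/-- `m > min{t+1, n-1} - max{1, β}`, over the integers. -/
def StopCond (n t m β : ℕ) : Prop :=
  (m : ℤ) > min ((t : ℤ) + 1) ((n : ℤ) - 1) - max 1 (β : ℤ)

open Classical in
/-- The early-stopping rule: decide as soon as the stopping condition holds (not before round 1
when `t + 2 < n`), on 0 if 0 occurs in the value vector and on 1 otherwise. -/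
noncomputable def stopRule (n t : ℕ) : DecisionProtocol n := fun _ s =>
  match s with
  | .crashed => .noop
  | .active V _ m =>
      if (0 < m ∨ n ≤ t + 2) ∧ StopCond n t m (Finset.univ.filter fun k => V k = none).card then
        if ∃ k, V k = some 0 then .decide 0 else .decide 1
      else .noop

end VecFloodSet

namespace VecFloodSet

/-! `Run.state_of_alive` reduces local states to reachability by message chains.

If the inequality holds, the surviving agents have equal value vectors. Indeed, agents unknown to a
survivor crashed in round 1, and while vectors differ every round has a new crash; so disagreement
at time `m` costs at least `max 1 β + (m - 1)` crashes. But at most `t` agents crash, and with `n -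
1` crashes nobody is left to disagree (`Run.Nonfailed.uniform`). As `β` is read off the vector, "all
survivors have this vector" persists under indistinguishability, hence is common knowledge
(`Run.Nonfailed.common`).

If it fails, a path of indistinguishable points refutes common knowledge. Any point is linked to a
run where exactly the unknown agents crash silently in round 1 (`Run.Nonfailed.sameC_silentRun`;
`Run.earlier` deals with the component `New`). These crashes are removed one at a time: in
`chainRun`, one survivor thinks that `k` was silent and another holds its value (`sameC_erase`). In
the failure-free run initial values are then changed one at a time (`sameC_update`), until the value
in question occurs nowhere.

Optimality follows because a decision on `v` by any SBA protocol makes `∃v` common knowledge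
(`IsSBA.common`). -/

variable {n t : ℕ}

/-! ### Flooding -/

/-- A message chain leads from `k` at time `0` to `j` at time `m`. -/
def Run.Reach (r : Run n t) : ℕ → Fin n → Fin n → Prop
  | 0 => fun j k => j = k
  | m + 1 => fun j k => ∃ a, r.F m a j = true ∧ r.Reach m a k

/-- `k` reaches `j` by time `m`, but not earlier. -/
def Run.Fresh (r : Run n t) : ℕ → Fin n → Fin n → Prop
  | 0 => fun j k => j = k
  | m + 1 => fun j k => r.Reach (m + 1) j k ∧ ¬ r.Reach m j k

lemma Run.Fresh.reach {r : Run n t} {m : ℕ} {j k : Fin n} (h : r.Fresh m j k) :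
    r.Reach m j k := by
  cases m with
  | zero => exact h
  | succ m => exact h.1

lemma Run.delivered_of_self (r : Run n t) {m : ℕ} {i : Fin n} (h : r.F m i i = true)
    (j : Fin n) : r.F m i j = true := by
  by_contra hj
  have := r.isCrash.crash_of_lost m i j (by simpa using hj)
  simp [h] at this

lemma Run.self_of_delivered_later (r : Run n t) {m m' : ℕ} {i j : Fin n} (hm : m < m')
    (h : r.F m' i j = true) : r.F m i i = true := by
  by_contra hj
  have := r.isCrash.silent_after m i (by simpa using hj) m' hm j
  simp [h] at this

open Classical in
/-- The value vector of `i`. -/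
noncomputable def Run.vec (r : Run n t) (m : ℕ) (i : Fin n) : Fin n → Option Value :=
  fun k => if r.Reach m i k then some (r.init k) else none

open Classical in
/-- The component `New` of the state of `i`. -/
noncomputable def Run.news (r : Run n t) (m : ℕ) (i : Fin n) : Info n :=
  Finset.univ.filter fun p => r.init p.2 = p.1 ∧ r.Fresh m i p.2

lemma Run.mem_news {r : Run n t} {m : ℕ} {i : Fin n} {v : Value} {k : Fin n} :
    (v, k) ∈ r.news m i ↔ r.init k = v ∧ r.Fresh m i k := by
  simp [Run.news]

lemma Run.state_succ (r : Run n t) (m : ℕ) (i : Fin n) :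
    r.state (m + 1) i = transition r.F i (r.state m i)
      (fun j => if r.F m j i = true then message j (r.state m j) i else none) := rfl

lemma Run.mem_received (r : Run n t) {m : ℕ} {i : Fin n}
    (ih : ∀ a, (∀ q < m, r.F q a a = true) →
      r.state m a = .active (r.vec m a) (r.news m a) m)
    (p : Value × Fin n) :
    p ∈ received (fun j => if r.F m j i = true then message j (r.state m j) i else none) ↔
      ∃ a, a ≠ i ∧ r.F m a i = true ∧ p ∈ r.news m a := by
  simp only [received, Finset.mem_biUnion, Finset.mem_univ, true_and]
  refine exists_congr fun a => ?_
  by_cases ha : r.F m a i = true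
  · rw [if_pos ha, ih a fun q hq => r.self_of_delivered_later hq ha]
    by_cases hi : a = i
    · simp [message, hi]
    · by_cases hn : r.news m a = ∅
      · simp [message, hn]
      · simp [message, hi, Ne.symm hi, hn, ha]
  · simp [ha]

/-- Sending only new pairs loses nothing: a sender `a` that knew `k` a round earlier would have told
`i` then, since an agent that still delivers a message now lost none in earlier rounds. -/
lemma Run.mem_received_iff (r : Run n t) {m : ℕ} {i : Fin n}
    (ih : ∀ a, (∀ q < m, r.F q a a = true) →
      r.state m a = .active (r.vec m a) (r.news m a) m)
    {k : Fin n} (hk : ¬ r.Reach m i k) (v : Value) :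
    (v, k) ∈ received (fun j => if r.F m j i = true then message j (r.state m j) i else none) ↔
      r.init k = v ∧ r.Reach (m + 1) i k := by
  rw [r.mem_received ih]
  constructor
  · rintro ⟨a, -, ha, h⟩
    rw [Run.mem_news] at h
    exact ⟨h.1, a, ha, h.2.reach⟩
  · rintro ⟨hv, a, ha, h⟩
    refine ⟨a, ?_, ha, ?_⟩
    · rintro rfl
      exact hk h
    · rw [Run.mem_news]
      refine ⟨hv, ?_⟩
      cases m with
      | zero => exact h
      | succ s =>
        exact ⟨h, fun h' => hk ⟨a, r.delivered_of_self
          (r.self_of_delivered_later (Nat.lt_succ_self s) ha) i, h'⟩⟩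

lemma Run.Reach.step {r : Run n t} {m : ℕ} {i k : Fin n} (h : r.Reach m i k)
    (hi : r.F m i i = true) : r.Reach (m + 1) i k := ⟨i, hi, h⟩

lemma Run.state_of_alive (r : Run n t) (m : ℕ) : ∀ i, (∀ q < m, r.F q i i = true) →
    r.state m i = .active (r.vec m i) (r.news m i) m := by
  induction m with
  | zero =>
    intro i _
    simp only [Run.state, initState, LocalState.active.injEq, and_true]
    constructor
    · funext k
      by_cases h : k = i
      · simp [Run.vec, Run.Reach, h]
      · simp [Run.vec, Run.Reach, h, Ne.symm h]
    · ext ⟨v, k⟩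
      rw [Run.mem_news, Finset.mem_singleton, Prod.mk.injEq, Run.Fresh]
      constructor
      · rintro ⟨rfl, rfl⟩; exact ⟨rfl, rfl⟩
      · rintro ⟨rfl, rfl⟩; exact ⟨rfl, rfl⟩
  | succ m ih =>
    intro i hi
    have hself := hi m (Nat.lt_succ_self m)
    have hvec : updateVec (r.vec m i)
        (received fun j => if r.F m j i = true then message j (r.state m j) i else none) =
        r.vec (m + 1) i := by
      funext k
      by_cases hk : r.Reach m i k
      · have := hk.step hself
        simp [updateVec, Run.vec, hk, this]
      · have h0 := r.mem_received_iff ih hk 0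
        have h1 := r.mem_received_iff ih hk 1
        have hv : r.vec m i k = none := by simp [Run.vec, hk]
        by_cases hk' : r.Reach (m + 1) i k
        · have h01 : ∀ v : Value, v = 0 ∨ v = 1 := by decide
          rcases h01 (r.init k) with h | h
          · rw [updateVec, if_pos hv, if_pos (h0.2 ⟨h, hk'⟩)]
            simp [Run.vec, hk', h]
          · rw [updateVec, if_pos hv, if_neg (fun hc => by simp [h] at h0; exact h0 hc),
              if_pos (h1.2 ⟨h, hk'⟩)]
            simp [Run.vec, hk', h]
        · rw [updateVec, if_pos hv, if_neg fun hc => hk' (h0.1 hc).2,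
            if_neg fun hc => hk' (h1.1 hc).2]
          simp [Run.vec, hk']
    rw [Run.state_succ, ih i fun q hq => hi q (by omega)]
    simp only [transition, hself, Bool.true_eq_false, if_false, LocalState.active.injEq, and_true]
    refine ⟨hvec, ?_⟩
    rw [hvec]
    ext ⟨v, k⟩
    rw [Run.mem_news, Run.Fresh, newInfo, Finset.mem_filter]
    simp only [Run.vec, Finset.mem_univ, true_and]
    by_cases hk : r.Reach m i k <;> by_cases hk' : r.Reach (m + 1) i k <;> simp [hk, hk']

lemma Run.state_of_crashed (r : Run n t) {m : ℕ} {i : Fin n} (h : ∃ q < m, r.F q i i = false) :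
    r.state m i = .crashed := by
  induction m with
  | zero => simp at h
  | succ m ih =>
    rw [Run.state_succ]
    by_cases hm : ∃ q < m, r.F q i i = false
    · rw [ih hm]
      rfl
    · rw [r.state_of_alive m i (by simpa using hm)]
      obtain ⟨q, hq, hqi⟩ := h
      obtain rfl | hlt := Nat.eq_or_lt_of_le (Nat.le_of_lt_succ hq)
      · simp [transition, hqi]
      · exact absurd ⟨q, hlt, hqi⟩ hm

lemma Run.nonfailed_succ_iff (r : Run n t) {m : ℕ} {i : Fin n} :
    r.Nonfailed (m + 1) i ↔ r.F m i i = true := by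
  constructor
  · intro h
    by_contra hF
    exact h (r.state_of_crashed ⟨m, Nat.lt_succ_self m, by simpa using hF⟩)
  · intro h hc
    rw [r.state_of_alive (m + 1) i fun q hq => ?_] at hc
    · cases hc
    · rcases Nat.lt_succ_iff_lt_or_eq.1 hq with hq | rfl
      · exact r.self_of_delivered_later hq h
      · exact h

lemma Run.nonfailed_zero (r : Run n t) (i : Fin n) : r.Nonfailed 0 i := by
  simp [Run.Nonfailed, Run.state, initState]

lemma Run.Nonfailed.self {r : Run n t} {m : ℕ} {i : Fin n} (h : r.Nonfailed m i) {q : ℕ}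
    (hq : q < m) : r.F q i i = true := by
  obtain ⟨m, rfl⟩ : ∃ s, m = s + 1 := ⟨m - 1, by omega⟩
  rw [r.nonfailed_succ_iff] at h
  rcases Nat.lt_succ_iff_lt_or_eq.1 hq with hq | rfl
  · exact r.self_of_delivered_later hq h
  · exact h

lemma Run.Nonfailed.mono {r : Run n t} {m q : ℕ} {i : Fin n} (h : r.Nonfailed m i)
    (hq : q ≤ m) : r.Nonfailed q i := by
  cases q with
  | zero => exact r.nonfailed_zero i
  | succ q => exact r.nonfailed_succ_iff.2 (h.self hq)

lemma Run.nonfailed_of_delivered (r : Run n t) {m : ℕ} {i j : Fin n} (h : r.F m i j = true) :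
    r.Nonfailed m i := by
  cases m with
  | zero => exact r.nonfailed_zero i
  | succ q => exact r.nonfailed_succ_iff.2 (r.self_of_delivered_later (Nat.lt_succ_self q) h)

lemma Run.Nonfailed.state_eq {r : Run n t} {m : ℕ} {i : Fin n} (h : r.Nonfailed m i) :
    r.state m i = .active (r.vec m i) (r.news m i) m :=
  r.state_of_alive m i fun _ hq => h.self hq

lemma Run.Nonfailed.reach_mono {r : Run n t} {m q : ℕ} {i k : Fin n} (h : r.Nonfailed m i)
    (hq : q ≤ m) (hk : r.Reach q i k) : r.Reach m i k := by
  induction m, hq using Nat.le_induction with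
  | base => exact hk
  | succ m _ ih => exact (ih (h.mono (Nat.le_succ m))).step (h.self (Nat.lt_succ_self m))

lemma Run.Nonfailed.reach_self {r : Run n t} {m : ℕ} {i : Fin n} (h : r.Nonfailed m i) :
    r.Reach m i i :=
  h.reach_mono (Nat.zero_le m) rfl

lemma Run.vec_eq_none_iff (r : Run n t) {m : ℕ} {i k : Fin n} :
    r.vec m i k = none ↔ ¬ r.Reach m i k := by
  by_cases h : r.Reach m i k <;> simp [Run.vec, h]

lemma Run.vec_eq_some_iff (r : Run n t) {m : ℕ} {i k : Fin n} {v : Value} :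
    r.vec m i k = some v ↔ r.Reach m i k ∧ r.init k = v := by
  by_cases h : r.Reach m i k <;> simp [Run.vec, h]

open Classical in
lemma Run.Nonfailed.beta_eq {r : Run n t} {m : ℕ} {i : Fin n} (h : r.Nonfailed m i) :
    r.beta m i = (Finset.univ.filter fun k => ¬ r.Reach m i k).card := by
  rw [Run.beta, h.state_eq, unknowns]
  congr 1
  ext k
  simp [r.vec_eq_none_iff]

/-- Two points look the same to an agent reached by the same agents with the same values, in the
same order as far as the last round is concerned. -/
lemma indist_of_reach {r r' : Run n t} {m : ℕ} {i : Fin n} (h : r.Nonfailed m i)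
    (h' : r'.Nonfailed m i) (hr : ∀ k, r.Reach m i k ↔ r'.Reach m i k)
    (hf : ∀ k, r.Reach m i k → (r.Fresh m i k ↔ r'.Fresh m i k))
    (hv : ∀ k, r.Reach m i k → r.init k = r'.init k) : Indist i (r, m) (r', m) := by
  simp only [Indist, h.state_eq, h'.state_eq, LocalState.active.injEq, and_true]
  constructor
  · funext k
    by_cases hk : r.Reach m i k
    · simp [Run.vec, hk, (hr k).1 hk, hv k hk]
    · simp [Run.vec, hk, mt (hr k).2 hk]
  · ext ⟨v, k⟩
    simp only [Run.news, Finset.mem_filter, Finset.mem_univ, true_and]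
    by_cases hk : r.Reach m i k
    · rw [hv k hk, hf k hk]
    · have h1 : ¬ r.Fresh m i k := fun h => hk h.reach
      have h2 : ¬ r'.Fresh m i k := fun h => hk ((hr k).2 h.reach)
      simp [h1, h2]

/-! ### Clean rounds -/

open Classical in
/-- The agents that have crashed by time `m`. -/
noncomputable def Run.dead (r : Run n t) (m : ℕ) : Finset (Fin n) :=
  Finset.univ.filter fun i => ¬ r.Nonfailed m i

lemma Run.mem_dead {r : Run n t} {m : ℕ} {i : Fin n} : i ∈ r.dead m ↔ ¬ r.Nonfailed m i := by
  simp [Run.dead]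

lemma Run.card_dead_le (r : Run n t) (m : ℕ) : (r.dead m).card ≤ t := by
  refine le_trans ?_ r.isCrash.card_faulty
  rw [← Set.ncard_coe_finset]
  refine Set.ncard_le_ncard (fun i hi => ?_) (Set.toFinite _)
  rw [Finset.mem_coe, Run.mem_dead] at hi
  cases m with
  | zero => exact absurd (r.nonfailed_zero i) hi
  | succ m => exact ⟨m, i, by simpa [r.nonfailed_succ_iff] using hi⟩

lemma Run.dead_subset (r : Run n t) {m q : ℕ} (h : m ≤ q) : r.dead m ⊆ r.dead q := by
  intro i
  simp only [Run.mem_dead]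
  exact mt fun hq => hq.mono h

lemma Run.exists_nonfailed (r : Run n t) (ht : t < n) (m : ℕ) : ∃ i, r.Nonfailed m i := by
  by_contra! h
  have : r.dead m = Finset.univ := by
    ext i
    simp [Run.mem_dead, h i]
  have h2 := r.card_dead_le m
  rw [this, Finset.card_univ, Fintype.card_fin] at h2
  omega

/-- The nonfailed agents have the same value vector. -/
def Run.Uniform (r : Run n t) (m : ℕ) : Prop :=
  ∀ i j k, r.Nonfailed m i → r.Nonfailed m j → r.Reach m i k → r.Reach m j k

/-- Without a new crash, whoever delivers a message in the round survives it, and so delivers to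
everybody. -/
lemma Run.uniform_of_clean (r : Run n t) {m : ℕ} (h : r.dead (m + 1) ⊆ r.dead m) :
    r.Uniform (m + 1) := by
  rintro _ j k _ _ ⟨a, ha, hk⟩
  refine ⟨a, r.delivered_of_self ?_ j, hk⟩
  rw [← r.nonfailed_succ_iff]
  by_contra hc
  exact Run.mem_dead.1 (h (Run.mem_dead.2 hc)) (r.nonfailed_of_delivered ha)

/-- Once the vectors agree they are frozen, as no sender has anything to add. -/
lemma Run.Uniform.reach_iff {r : Run n t} {m q : ℕ} (h : r.Uniform m) (hq : m ≤ q) :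
    ∀ {i j k : Fin n}, r.Nonfailed m i → r.Nonfailed q j → (r.Reach q j k ↔ r.Reach m i k) := by
  induction q, hq using Nat.le_induction with
  | base => exact fun hi hj => ⟨h _ _ _ hj hi, h _ _ _ hi hj⟩
  | succ q hq ih =>
    intro i j k hi hj
    constructor
    · rintro ⟨a, ha, hk⟩
      exact (ih hi (r.nonfailed_of_delivered ha)).1 hk
    · exact fun hk => ((ih hi (hj.mono (Nat.le_succ q))).2 hk).step (hj.self (Nat.lt_succ_self q))

lemma Run.Uniform.mono {r : Run n t} {m q : ℕ} (h : r.Uniform m) (hq : m ≤ q) : r.Uniform q :=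
  fun _ _ _ hi hj hk => (h.reach_iff hq (hi.mono hq) hj).2 ((h.reach_iff hq (hi.mono hq) hi).1 hk)

/-- A clean round would have made the vectors equal for good, so each of the first `m + 1` rounds
has a crash; those of round 1 are counted in full. -/
lemma Run.card_dead_of_not_uniform (r : Run n t) {m : ℕ} (h : ¬ r.Uniform (m + 1)) :
    max 1 (r.dead 1).card + m ≤ (r.dead (m + 1)).card := by
  have key : ∀ q ≤ m, (r.dead q).card < (r.dead (q + 1)).card := by
    intro q hq
    refine Finset.card_lt_card ⟨r.dead_subset (Nat.le_succ q), fun hc => h ?_⟩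
    exact (r.uniform_of_clean hc).mono (by omega)
  have : ∀ q ≤ m, max 1 (r.dead 1).card + q ≤ (r.dead (q + 1)).card := by
    intro q
    induction q with
    | zero =>
      intro hq
      have := key 0 hq
      simp only [Nat.zero_add] at this
      simp only [Nat.zero_add, Nat.add_zero]
      omega
    | succ q ih =>
      intro hq
      have := ih (by omega)
      have := key (q + 1) hq
      omega
  exact this m le_rfl

lemma Run.mem_dead_one_of_not_reach (r : Run n t) {m : ℕ} {i k : Fin n}
    (h : r.Nonfailed (m + 1) i) (hk : ¬ r.Reach (m + 1) i k) : k ∈ r.dead 1 := by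
  rw [Run.mem_dead]
  intro h1
  exact hk (h.reach_mono (q := 1) (by omega) ⟨k, r.delivered_of_self (h1.self one_pos) i, rfl⟩)

lemma Run.Nonfailed.beta_le {r : Run n t} {m : ℕ} {i : Fin n} (h : r.Nonfailed (m + 1) i) :
    r.beta (m + 1) i ≤ (r.dead 1).card := by
  classical
  rw [h.beta_eq]
  refine Finset.card_le_card fun k hk => ?_
  exact r.mem_dead_one_of_not_reach h (by simpa using hk)

lemma Run.Nonfailed.beta_zero {r : Run n t} {i : Fin n} : r.beta 0 i = n - 1 := by
  classical
  rw [(r.nonfailed_zero i).beta_eq]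
  have : (Finset.univ.filter fun k => ¬ r.Reach 0 i k) = Finset.univ.erase i := by
    ext k
    rw [Finset.mem_filter, Run.Reach]
    simp [eq_comm]
  rw [this, Finset.card_erase_of_mem (Finset.mem_univ _), Finset.card_univ, Fintype.card_fin]

/-- At most one agent survives. This accounts for the bound `n - 1` in the minimum. -/
lemma Run.uniform_of_card (r : Run n t) {m : ℕ} (h : n ≤ (r.dead m).card + 1) :
    r.Uniform m := by
  intro i j k hi hj hk
  suffices i = j by rwa [← this]
  by_contra hne
  have hsub : r.dead m ⊆ (Finset.univ.erase i).erase j := by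
    intro a ha
    rw [Run.mem_dead] at ha
    simp only [Finset.mem_erase, Finset.mem_univ, and_true]
    constructor
    · rintro rfl; exact ha hj
    · rintro rfl; exact ha hi
  have h2 := Finset.card_le_card hsub
  rw [Finset.card_erase_of_mem (by simp [Ne.symm hne]),
    Finset.card_erase_of_mem (Finset.mem_univ _), Finset.card_univ, Fintype.card_fin] at h2
  have := i.2
  have := j.2
  have : (i : ℕ) ≠ j := fun h => hne (Fin.ext h)
  omega

lemma Run.Nonfailed.uniform {r : Run n t} {m : ℕ} {i : Fin n} (h : r.Nonfailed m i)
    (hg : 0 < m ∨ n ≤ t + 2) (hs : StopCond n t m (r.beta m i)) : r.Uniform m := by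
  cases m with
  | zero =>
    -- At time 0 `β = n - 1`, and under the guard `n ≤ t + 2` the condition forces `n = 1`. Without
    -- the guard it would also hold for `n > t + 2`, where the vectors differ.
    rw [StopCond, Run.Nonfailed.beta_zero] at hs
    have := i.2
    exact r.uniform_of_card (by omega)
  | succ m =>
    by_contra hu
    have h1 := r.card_dead_of_not_uniform hu
    have h2 := h.beta_le
    have h3 := r.card_dead_le (m + 1)
    have h4 : ¬ n ≤ (r.dead (m + 1)).card + 1 := fun hn => hu (r.uniform_of_card hn)
    rw [StopCond] at hs
    omega

/-! ### Common knowledge -/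

lemma C.apply_of_nonfailed {φ : Formula n t} {p q : Point n t} {i : Fin n} (h : C φ p)
    (hi : p.1.Nonfailed p.2 i) (hq : Indist i p q) : φ q := by
  have := h 1 le_rfl
  exact this i hi q hq

lemma C.of_indist {φ : Formula n t} {p q : Point n t} {i : Fin n} (h : C φ p)
    (hi : p.1.Nonfailed p.2 i) (hq : Indist i p q) : C φ q := by
  intro k hk
  have := h (k + 1) (by omega)
  rw [Function.iterate_succ_apply'] at this
  exact this i hi q hq

/-- The induction rule for common knowledge: `ψ` holds at every point that a path of
indistinguishable points can reach. -/
lemma C.of_invariant {φ ψ : Formula n t} (hφ : ∀ p, ψ p → φ p)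
    (hψ : ∀ p i q, ψ p → p.1.Nonfailed p.2 i → Indist i p q → ψ q) {p : Point n t}
    (h : ψ p) : C φ p := by
  intro k _
  induction k generalizing p with
  | zero => exact hφ p h
  | succ k ih =>
    rw [Function.iterate_succ_apply']
    intro i hi q hq
    rcases Nat.eq_zero_or_pos k with rfl | hk
    · exact hφ q (hψ p i q h hi hq)
    · exact ih (hψ p i q h hi hq) hk

/-- The same facts are common knowledge. -/
def SameC (p q : Point n t) : Prop := ∀ φ, C φ p ↔ C φ q

lemma SameC.trans {p q s : Point n t} (h : SameC p q) (h' : SameC q s) : SameC p s :=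
  fun φ => (h φ).trans (h' φ)

lemma SameC.symm {p q : Point n t} (h : SameC p q) : SameC q p := fun φ => (h φ).symm

lemma SameC.refl (p : Point n t) : SameC p p := fun _ => Iff.rfl

lemma sameC_of_indist {p q : Point n t} {i : Fin n} (hi : p.1.Nonfailed p.2 i)
    (h : Indist i p q) : SameC p q := by
  have hi' : q.1.Nonfailed q.2 i := by
    unfold Run.Nonfailed at hi ⊢
    rwa [← h]
  exact fun φ => ⟨fun hc => hc.of_indist hi h, fun hc => hc.of_indist hi' h.symm⟩

lemma Indist.nonfailed {p q : Point n t} {i : Fin n} (h : Indist i p q)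
    (hi : p.1.Nonfailed p.2 i) : q.1.Nonfailed q.2 i := by
  unfold Run.Nonfailed at hi ⊢
  rwa [← h]

lemma Indist.vec_eq {p q : Point n t} {i : Fin n} (h : Indist i p q)
    (hi : p.1.Nonfailed p.2 i) : p.1.vec p.2 i = q.1.vec q.2 i ∧ p.2 = q.2 := by
  have h' := h.nonfailed hi
  rw [Indist, hi.state_eq, h'.state_eq, LocalState.active.injEq] at h
  exact ⟨h.1, h.2.2⟩

lemma Run.Uniform.vec_eq {r : Run n t} {m : ℕ} (h : r.Uniform m) {i j : Fin n}
    (hi : r.Nonfailed m i) (hj : r.Nonfailed m j) : r.vec m i = r.vec m j := by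
  funext k
  have := h.reach_iff le_rfl hi hj (k := k)
  by_cases hk : r.Reach m i k <;> simp [Run.vec, this, hk]

open Classical in
lemma Run.Nonfailed.beta_eq_vec {r : Run n t} {m : ℕ} {i : Fin n} (h : r.Nonfailed m i) :
    r.beta m i = (Finset.univ.filter fun k => r.vec m i k = none).card := by
  rw [h.beta_eq]
  simp only [r.vec_eq_none_iff]

lemma Run.Nonfailed.beta_congr {r r' : Run n t} {m m' : ℕ} {i j : Fin n} (h : r.Nonfailed m i)
    (h' : r'.Nonfailed m' j) (hv : r.vec m i = r'.vec m' j) : r.beta m i = r'.beta m' j := by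
  rw [h.beta_eq_vec, h'.beta_eq_vec, hv]

lemma Run.Nonfailed.common {r : Run n t} {m : ℕ} {i : Fin n} (h : r.Nonfailed m i)
    (hg : 0 < m ∨ n ≤ t + 2) (hs : StopCond n t m (r.beta m i)) :
    C (existsValue (r.init i)) (r, m) := by
  -- The second clause supplies a survivor whose vector exhibits the value of `i`.
  let ψ : Formula n t := fun p => p.2 = m ∧ (∃ j, p.1.Nonfailed m j) ∧
    ∀ j, p.1.Nonfailed m j → p.1.vec m j = r.vec m i
  refine C.of_invariant (ψ := ψ) ?_ ?_ ⟨rfl, ⟨i, h⟩, fun j hj => ?_⟩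
  · rintro p ⟨-, ⟨j, hj⟩, hv⟩
    have : r.vec m i i = some (r.init i) := r.vec_eq_some_iff.2 ⟨h.reach_self, rfl⟩
    rw [← hv j hj, p.1.vec_eq_some_iff] at this
    exact ⟨i, this.2⟩
  · rintro ⟨p, pm⟩ j ⟨q, qm⟩ ⟨hm, -, hv⟩ hj hi
    obtain ⟨hv', hm'⟩ := hi.vec_eq hj
    have hj' := hi.nonfailed hj
    dsimp only at hm hm' hj hj' hv hv'
    subst hm' hm
    have hvj := hv'.symm.trans (hv j hj)
    -- The condition depends only on time and vector, so it carries over to `q` and makes all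
    -- vectors there equal too.
    have hs' : StopCond n t pm (q.beta pm j) := by rwa [hj'.beta_congr h hvj]
    have hu := hj'.uniform hg hs'
    exact ⟨rfl, ⟨j, hj'⟩, fun a ha => (hu.vec_eq ha hj').trans hvj⟩
  · exact (h.uniform hg hs).vec_eq hj h

/-! ### Runs with initial crashes only -/

/-- The run in which the agents in `B` crash in round 1 without sending anything, and no others
crash. -/
def silentRun (B : Finset (Fin n)) (hB : B.card ≤ t) (w : Fin n → Value) : Run n t where
  F _ a _ := decide (a ∉ B)
  isCrash :=
    { crash_of_lost := fun _ _ _ h => h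
      silent_after := fun _ _ h _ _ _ => h
      card_faulty := by
        refine le_trans ?_ hB
        rw [← Set.ncard_coe_finset]
        refine Set.ncard_le_ncard ?_ (Set.toFinite _)
        rintro i ⟨_, _, h⟩
        simpa using h }
  init := w

section silentRun

variable {B : Finset (Fin n)} {hB : B.card ≤ t} {w : Fin n → Value}

lemma silentRun_nonfailed {m : ℕ} {i : Fin n} (hi : i ∉ B) :
    (silentRun B hB w).Nonfailed m i := by
  cases m with
  | zero => exact Run.nonfailed_zero _ i
  | succ m => exact (Run.nonfailed_succ_iff _).2 (by simp [silentRun, hi])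

lemma silentRun_reach {m : ℕ} {i k : Fin n} (hi : i ∉ B) :
    (silentRun B hB w).Reach (m + 1) i k ↔ k ∉ B := by
  induction m generalizing i with
  | zero => simp [Run.Reach, silentRun]
  | succ m ih =>
    rw [Run.Reach]
    constructor
    · rintro ⟨a, ha, hk⟩
      exact (ih (by simpa [silentRun] using ha)).1 hk
    · exact fun hk => ⟨i, by simp [silentRun, hi], (ih hi).2 hk⟩

end silentRun

/-- In a silent run everything is learned in round 1, so it can match the state of `i` only if `New`
is empty or the time is 1. -/
lemma Run.sameC_silentRun_of_not_fresh (r : Run n t) {m : ℕ} {i : Fin n}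
    (h : r.Nonfailed (m + 1) i) (hf : ∀ k, r.Reach (m + 1) i k → m = 0 ∨ r.Reach m i k)
    {B : Finset (Fin n)} (hB : B.card ≤ t) (hr : ∀ k, k ∉ B ↔ r.Reach (m + 1) i k)
    {w : Fin n → Value} (hw : ∀ k ∉ B, r.init k = w k) :
    SameC (r, m + 1) (silentRun B hB w, m + 1) := by
  have hi : i ∉ B := (hr i).2 h.reach_self
  refine sameC_of_indist (i := i) h (indist_of_reach h (silentRun_nonfailed hi)
    (fun k => (hr k).symm.trans (silentRun_reach hi).symm) (fun k hk => ?_)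
    (fun k hk => hw k ((hr k).2 hk)))
  have hkB := (hr k).2 hk
  refine and_congr ((hr k).symm.trans (silentRun_reach hi).symm) (not_congr ?_)
  cases m with
  | zero => exact Iff.rfl
  | succ m => exact ⟨fun _ => (silentRun_reach hi).2 hkB, fun _ => (hf k hk).resolve_left (by omega)⟩

/-! ### Hearing the news one round earlier -/

open Classical in
/-- The adversary in which `c` receives in round `m + 1` all that the senders to `i` in round
`m + 2` receive, and behaves in round `m + 2` like a nonfailed copy of `i`. -/
noncomputable def earlierF (F : ℕ → Fin n → Fin n → Bool) (m : ℕ) (i c : Fin n) :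
    ℕ → Fin n → Fin n → Bool := fun q a j =>
  if q = m ∧ j = c then decide (∃ x, F (m + 1) x i = true ∧ F m a x = true)
  else if q = m + 1 ∧ a = c then true
  else if q = m + 1 ∧ j = c then F (m + 1) a i
  else F q a j

/-- The run with the adversary `earlierF`. -/
noncomputable def Run.earlier (r : Run n t) (m : ℕ) (i c : Fin n)
    (hi : r.F (m + 1) i i = true) (hc : r.F (m + 1) c i = true) : Run n t where
  F := earlierF r.F m i c
  isCrash :=
    { crash_of_lost := by
        intro q a j h
        -- Since `c` still delivers in round `m + 2`, it lost nothing in round `m + 1`.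
        have hcm := r.self_of_delivered_later (Nat.lt_succ_self m) hc
        by_cases hac : a = c
        · subst hac
          by_cases hqm : q = m
          · subst hqm
            simp only [earlierF] at h ⊢
            by_cases hj : j = a
            · rw [hj] at h
              simpa using h
            · simp [hj, r.delivered_of_self hcm] at h
          · by_cases hqm' : q = m + 1
            · simp [earlierF, hqm'] at h
            · simp only [earlierF, hqm, hqm', false_and, if_false] at h ⊢
              exact r.isCrash.crash_of_lost _ _ _ h
        · have haa : earlierF r.F m i c q a a = r.F q a a := by simp [earlierF, hac]
          rw [haa]
          by_contra hF
          have hF : r.F q a a = true := by simpa using hF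
          have hFj := r.delivered_of_self hF
          simp only [earlierF] at h
          split_ifs at h with h1 h2 h3
          · obtain ⟨rfl, rfl⟩ := h1
            simp only [decide_eq_false_iff_not] at h
            exact h ⟨i, hi, hFj i⟩
          · obtain ⟨rfl, rfl⟩ := h3
            simp [hFj] at h
          · simp [hFj] at h
      silent_after := by
        intro q a h q' hq j
        have hF : r.F q a a = false ∧ (a = c → m + 1 < q) := by
          by_cases hac : a = c
          · subst hac
            have hcm := r.self_of_delivered_later (Nat.lt_succ_self m) hc
            by_cases hqm : q = m
            · subst hqm
              simp only [earlierF, and_self, if_true, decide_eq_false_iff_not] at h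
              exact absurd ⟨a, hc, hcm⟩ h
            · by_cases hqm' : q = m + 1
              · simp [earlierF, hqm'] at h
              · simp only [earlierF, hqm, hqm', false_and, if_false] at h
                refine ⟨h, fun _ => ?_⟩
                by_contra hlt
                have := r.self_of_delivered_later (m := q) (by omega) hc
                simp [h] at this
          · simp only [earlierF, hac, and_false, if_false] at h
            exact ⟨h, fun hc => absurd hc hac⟩
        have hs := r.isCrash.silent_after q a hF.1
        simp only [earlierF]
        split_ifs with h1 h2 h3
        · simp [← h1.1, hs q' hq]
        · exact absurd (hF.2 h2.2) (by omega)
        · exact hs _ (by omega) _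
        · exact hs _ hq _
      card_faulty := by
        refine le_trans (Set.ncard_le_ncard ?_ (Set.toFinite _)) r.isCrash.card_faulty
        rintro a ⟨q, j, h⟩
        simp only [earlierF] at h
        split_ifs at h with h1 h2 h3
        -- A message lost to `c` here was lost to `i` in `r`, as `i` is one of its own round `m + 2`
        -- senders; no new agent becomes faulty.
        · simp only [decide_eq_false_iff_not, not_exists, not_and] at h
          exact ⟨m, i, by simpa using h i hi⟩
        · exact ⟨_, _, h⟩
        · exact ⟨_, _, h⟩ }
  init := r.init

section earlier

variable {r : Run n t} {m : ℕ} {i c : Fin n} {hi : r.F (m + 1) i i = true}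
  {hc : r.F (m + 1) c i = true}

lemma Run.earlier_reach_of_le {q : ℕ} (hq : q ≤ m) (a k : Fin n) :
    (r.earlier m i c hi hc).Reach q a k ↔ r.Reach q a k := by
  induction q generalizing a with
  | zero => rfl
  | succ q ih =>
    have hqm : q ≠ m := by omega
    have hqm' : q ≠ m + 1 := by omega
    simp [Run.Reach, Run.earlier, earlierF, hqm, hqm', ← ih (by omega)]

lemma Run.earlier_reach_of_ne {a : Fin n} (ha : a ≠ c) (k : Fin n) :
    (r.earlier m i c hi hc).Reach (m + 1) a k ↔ r.Reach (m + 1) a k := by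
  rw [Run.Reach, Run.Reach]
  refine exists_congr fun b => ?_
  rw [Run.earlier_reach_of_le le_rfl]
  simp [Run.earlier, earlierF, ha]

lemma Run.earlier_reach_self (k : Fin n) :
    (r.earlier m i c hi hc).Reach (m + 1) c k ↔ r.Reach (m + 2) i k := by
  have hF : ∀ b, (r.earlier m i c hi hc).F m b c = true ↔
      ∃ x, r.F (m + 1) x i = true ∧ r.F m b x = true := by
    intro b
    simp [Run.earlier, earlierF]
  constructor
  · rintro ⟨b, hb, hk⟩
    rw [hF] at hb
    obtain ⟨x, hx, hbx⟩ := hb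
    rw [Run.earlier_reach_of_le le_rfl] at hk
    exact ⟨x, hx, b, hbx, hk⟩
  · rintro ⟨x, hx, b, hbx, hk⟩
    exact ⟨b, (hF b).2 ⟨x, hx, hbx⟩, (Run.earlier_reach_of_le le_rfl _ _).2 hk⟩

lemma Run.earlier_F_last {j : Fin n} (hj : j = i ∨ j = c) (a : Fin n) :
    (r.earlier m i c hi hc).F (m + 1) a j = r.F (m + 1) a i := by
  by_cases hac : a = c
  · subst hac
    simp [Run.earlier, earlierF, hc]
  · rcases hj with rfl | rfl
    · simp [Run.earlier, earlierF, hac]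
    · simp [Run.earlier, earlierF, hac]

lemma Run.earlier_reach_last {j : Fin n} (hj : j = i ∨ j = c) (k : Fin n) :
    (r.earlier m i c hi hc).Reach (m + 2) j k ↔ r.Reach (m + 2) i k := by
  constructor
  · rintro ⟨a, ha, hk⟩
    rw [Run.earlier_F_last hj] at ha
    by_cases hac : a = c
    · subst hac
      exact Run.earlier_reach_self k |>.1 hk
    · exact ⟨a, ha, (Run.earlier_reach_of_ne hac k).1 hk⟩
  · intro hk
    exact ⟨c, (Run.earlier_F_last hj c).trans hc, (Run.earlier_reach_self k).2 hk⟩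

end earlier

/-- A nonfailed agent considers possible, up to common knowledge, the run with initial crashes only
that has the same unknown entries. -/
lemma Run.Nonfailed.sameC_silentRun {r : Run n t} {m : ℕ} {i : Fin n}
    (h : r.Nonfailed (m + 1) i) {B : Finset (Fin n)} (hB : B.card ≤ t)
    (hr : ∀ k, k ∉ B ↔ r.Reach (m + 1) i k) {w : Fin n → Value}
    (hw : ∀ k ∉ B, r.init k = w k) :
    SameC (r, m + 1) (silentRun B hB w, m + 1) := by
  by_cases hf : ∀ k, r.Reach (m + 1) i k → m = 0 ∨ r.Reach m i k
  · exact r.sameC_silentRun_of_not_fresh h hf hB hr hw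
  · push Not at hf
    -- The value of `d` is news to `i`, brought in the last round by some `c`. Letting `c` know
    -- everything a round earlier leaves the state of `i` unchanged, while `c` ends with the same
    -- vector and empty `New`, so that the previous case applies to `c`.
    obtain ⟨d, hd, hm, hd'⟩ := hf
    obtain ⟨m, rfl⟩ : ∃ q, m = q + 1 := ⟨m - 1, by omega⟩
    obtain ⟨c, hc, hcd⟩ := hd
    have hi := h.self (Nat.lt_succ_self _)
    have hci : i ≠ c := by
      rintro rfl
      exact hd' hcd
    have hni : (r.earlier m i c hi hc).Nonfailed (m + 2) i :=
      (Run.nonfailed_succ_iff _).2 ((Run.earlier_F_last (Or.inl rfl) i).trans hi)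
    have hnc : (r.earlier m i c hi hc).Nonfailed (m + 2) c :=
      (Run.nonfailed_succ_iff _).2 ((Run.earlier_F_last (Or.inr rfl) c).trans hc)
    have hlink : Indist i (r, m + 2) (r.earlier m i c hi hc, m + 2) :=
      indist_of_reach h hni (fun k => (Run.earlier_reach_last (Or.inl rfl) k).symm)
        (fun k _ => and_congr (Run.earlier_reach_last (Or.inl rfl) k).symm
          (not_congr (Run.earlier_reach_of_ne hci k).symm)) (fun _ _ => rfl)
    refine (sameC_of_indist h hlink).trans ?_
    exact Run.sameC_silentRun_of_not_fresh _ hnc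
      (fun k hk => Or.inr ((Run.earlier_reach_self k).2 ((Run.earlier_reach_last (Or.inr rfl) k).1 hk)))
      hB (fun k => (hr k).trans (Run.earlier_reach_last (Or.inr rfl) k).symm) hw

/-! ### A secret passed along a chain of crashing agents -/

open Classical in
/-- The agents in `B` crash in round 1, and `c s` crashes in round `s + 1` for `s < m`, delivering
its message only to `c (s + 1)`. -/
noncomputable def chainF (B : Finset (Fin n)) (c : ℕ → Fin n) (m : ℕ) :
    ℕ → Fin n → Fin n → Bool := fun q a j =>
  decide ((a ∉ B ∧ ∀ s < m, a = c s → q < s) ∨ (q < m ∧ a = c q ∧ j = c (q + 1)))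

/-- The run with the adversary `chainF`. -/
noncomputable def chainRun (B : Finset (Fin n)) (c : ℕ → Fin n) (m : ℕ) (w : Fin n → Value)
    (hc : Set.InjOn c (Set.Iic (m + 1))) (h0 : c 0 ∈ B)
    (hcB : ∀ s ≤ m, c (s + 1) ∉ B) (hB : B.card + m ≤ t) : Run n t where
  F := chainF B c (m + 1)
  isCrash :=
    { crash_of_lost := by
        intro q a j h
        simp only [chainF, decide_eq_false_iff_not, not_or] at h ⊢
        refine ⟨h.1, ?_⟩
        rintro ⟨hq, h1, h2⟩
        have := hc (by simp; omega) (by simp; omega) (h1.symm.trans h2)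
        omega
      silent_after := by
        intro q a h q' hq j
        simp only [chainF, decide_eq_false_iff_not, not_or] at h ⊢
        have h1 : ¬ (a ∉ B ∧ ∀ s < m + 1, a = c s → q' < s) :=
          fun hh => h.1 ⟨hh.1, fun s hs has => hq.trans (hh.2 s hs has)⟩
        refine ⟨h1, ?_⟩
        rintro ⟨hq', rfl, -⟩
        obtain ⟨q', rfl⟩ : ∃ s, q' = s + 1 := ⟨q' - 1, by omega⟩
        refine h.1 ⟨hcB q' (by omega), fun s hs has => ?_⟩
        have := hc (by simp; omega) (by simp; omega) has
        omega
      card_faulty := by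
        -- The head `c 0` is already in `B`, so the chain adds only the faults `c 1, …, c m`.
        have hsub : {i : Fin n | ∃ q j, chainF B c (m + 1) q i j = false} ⊆
            ((B ∪ (Finset.Icc 1 m).image c : Finset (Fin n)) : Set (Fin n)) := by
          rintro a ⟨q, j, h⟩
          simp only [chainF, decide_eq_false_iff_not, not_or] at h
          rw [Finset.mem_coe, Finset.mem_union, Finset.mem_image]
          by_contra hne
          push Not at hne
          refine h.1 ⟨hne.1, fun s hs has => ?_⟩
          rcases Nat.eq_zero_or_pos s with rfl | hpos
          · exact absurd (has ▸ h0) hne.1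
          · exact absurd has.symm (hne.2 s (by simp; omega))
        refine (Set.ncard_le_ncard hsub (Set.toFinite _)).trans ?_
        rw [Set.ncard_coe_finset]
        refine (Finset.card_union_le _ _).trans ?_
        have := Finset.card_image_le (s := Finset.Icc 1 m) (f := c)
        rw [Nat.card_Icc] at this
        omega }
  init := w

section chainRun

variable {B : Finset (Fin n)} {c : ℕ → Fin n} {m : ℕ} {w : Fin n → Value}
  {hc : Set.InjOn c (Set.Iic (m + 1))} {h0 : c 0 ∈ B} {hcB : ∀ s ≤ m, c (s + 1) ∉ B}
  {hB : B.card + m ≤ t}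

lemma chainRun_F {q : ℕ} {a j : Fin n} :
    (chainRun B c m w hc h0 hcB hB).F q a j = true ↔
      (a ∉ B ∧ ∀ s < m + 1, a = c s → q < s) ∨ (q < m + 1 ∧ a = c q ∧ j = c (q + 1)) := by
  simp [chainRun, chainF]

/-- The value of `c 0` has one surviving holder at a time: `c (q + 1)` crashes while passing it on,
to `c (q + 2)` only. -/
lemma chainRun_reach {q : ℕ} (hq : q ≤ m) {a x : Fin n}
    (ha : (chainRun B c m w hc h0 hcB hB).Nonfailed (q + 1) a) :
    (chainRun B c m w hc h0 hcB hB).Reach (q + 1) a x ↔ x ∉ B ∨ (x = c 0 ∧ a = c (q + 1)) := by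
  induction q generalizing a with
  | zero =>
    constructor
    · rintro ⟨_, hF, rfl⟩
      rw [chainRun_F] at hF
      exact hF.imp And.left And.right
    · intro h
      refine ⟨x, chainRun_F.2 (h.imp (fun hx => ⟨hx, fun s _ hs => ?_⟩)
        fun hx => ⟨Nat.succ_pos m, hx⟩), rfl⟩
      rcases Nat.eq_zero_or_pos s with rfl | hpos
      · exact absurd (hs ▸ h0) hx
      · exact hpos
  | succ q ih =>
    constructor
    · rintro ⟨b, hF, hx⟩
      rw [ih (by omega) (Run.nonfailed_of_delivered _ hF)] at hx
      refine hx.imp_right ?_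
      rintro ⟨rfl, rfl⟩
      rw [chainRun_F] at hF
      refine ⟨rfl, ?_⟩
      rcases hF with hF | hF
      · exact absurd (hF.2 (q + 1) (by omega) rfl) (lt_irrefl _)
      · exact hF.2.2
    · rintro (hx | ⟨rfl, rfl⟩)
      · exact ⟨a, ha.self (Nat.lt_succ_self _),
          (ih (by omega) (ha.mono (Nat.le_succ _))).2 (Or.inl hx)⟩
      · have hF : (chainRun B c m w hc h0 hcB hB).F (q + 1) (c (q + 1)) (c (q + 1 + 1)) = true :=
          chainRun_F.2 (Or.inr ⟨by omega, rfl, rfl⟩)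
        exact ⟨_, hF, (ih (by omega) (Run.nonfailed_of_delivered _ hF)).2 (Or.inr ⟨rfl, rfl⟩)⟩

lemma chainRun_nonfailed {a : Fin n} (ha : a ∉ B) (hac : ∀ s ≤ m, a ≠ c s) :
    (chainRun B c m w hc h0 hcB hB).Nonfailed (m + 1) a :=
  (Run.nonfailed_succ_iff _).2 (chainRun_F.2 (Or.inl ⟨ha, fun s hs h =>
    absurd h (hac s (by omega))⟩))

end chainRun

/-- Besides `k`, a chain needs `m + 1` agents outside `B` to carry the secret and one more survivor,
`c (m + 2)`, who never hears it. -/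
lemma exists_chain (B : Finset (Fin n)) {k : Fin n} (hk : k ∈ B) {m : ℕ}
    (h : B.card + m + 2 ≤ n) :
    ∃ c : ℕ → Fin n, c 0 = k ∧ Set.InjOn c (Set.Iic (m + 2)) ∧ ∀ s ≤ m + 1, c (s + 1) ∉ B := by
  have hcard : m + 2 ≤ Bᶜ.card := by
    rw [Finset.card_compl, Fintype.card_fin]
    omega
  let e := Bᶜ.orderEmbOfFin rfl
  have he : ∀ s, e s ∉ B := fun s => Finset.mem_compl.1 (Bᶜ.orderEmbOfFin_mem rfl s)
  let f : ℕ → Fin n := fun s => if hs : s < Bᶜ.card then e ⟨s, hs⟩ else k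
  have hf : ∀ s (hs : s < Bᶜ.card), f s = e ⟨s, hs⟩ := fun s hs => dif_pos hs
  let c : ℕ → Fin n := fun s => Nat.casesOn s k f
  have hcB : ∀ s ≤ m + 1, c (s + 1) ∉ B := by
    intro s hs
    change f s ∉ B
    rw [hf s (by omega)]
    exact he _
  refine ⟨c, rfl, ?_, hcB⟩
  intro a ha b hb hab
  rw [Set.mem_Iic] at ha hb
  cases a with
  | zero =>
    cases b with
    | zero => rfl
    | succ b => exact absurd (hab ▸ hk) (hcB b (by omega))
  | succ a =>
    cases b with
    | zero => exact absurd (hab.symm ▸ hk) (hcB a (by omega))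
    | succ b =>
      change f a = f b at hab
      rw [hf a (by omega), hf b (by omega)] at hab
      simpa using e.injective hab

/-- Common knowledge does not tell whether one of the initially crashed agents really crashed. -/
lemma sameC_erase {B : Finset (Fin n)} {k : Fin n} (hk : k ∈ B) {m : ℕ} (hB : B.card ≤ t)
    (h1 : B.card + m ≤ t) (h2 : B.card + m + 2 ≤ n) (w : Fin n → Value) :
    SameC (silentRun B hB w, m + 1)
      (silentRun (B.erase k) ((Finset.card_erase_le).trans hB) w, m + 1) := by
  obtain ⟨c, rfl, hc, hcB⟩ := exists_chain B hk h2
  have hc' : Set.InjOn c (Set.Iic (m + 1)) := hc.mono (Set.Iic_subset_Iic.2 (by omega))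
  have hne : ∀ {p q}, p ≤ m + 2 → q ≤ m + 2 → p ≠ q → c p ≠ c q :=
    fun hp hq hpq h => hpq (hc hp hq h)
  let A : Run n t := chainRun B c m w hc' hk (fun s hs => hcB s (by omega)) h1
  have hi : A.Nonfailed (m + 1) (c (m + 2)) :=
    chainRun_nonfailed (hcB _ le_rfl) fun s hs => hne le_rfl (by omega) (by omega)
  have hj : A.Nonfailed (m + 1) (c (m + 1)) :=
    chainRun_nonfailed (hcB _ (by omega)) fun s hs => hne (by omega) (by omega) (by omega)
  -- At the same point of `A`, the ignorant `c (m + 2)` leads to `B`, and the last holder `c (m +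
  -- 1)` of the secret leads to `B.erase (c 0)`.
  have e1 : SameC (A, m + 1) (silentRun B hB w, m + 1) := by
    refine hi.sameC_silentRun hB (fun x => ?_) fun _ _ => rfl
    rw [chainRun_reach le_rfl hi]
    exact ⟨Or.inl, fun h => h.resolve_right fun h => hne le_rfl (by omega) (by omega) h.2⟩
  have e2 : SameC (A, m + 1)
      (silentRun (B.erase (c 0)) ((Finset.card_erase_le).trans hB) w, m + 1) := by
    refine hj.sameC_silentRun _ (fun x => ?_) fun _ _ => rfl
    rw [chainRun_reach le_rfl hj, Finset.mem_erase]
    simp only [and_true]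
    tauto
  exact e1.symm.trans e2

lemma sameC_silentRun_empty {m : ℕ} (w : Fin n → Value) (B : Finset (Fin n)) (hB : B.card ≤ t)
    (h1 : B.card + m ≤ t) (h2 : B.card + m + 2 ≤ n) :
    SameC (silentRun B hB w, m + 1) (silentRun (t := t) ∅ (by simp) w, m + 1) := by
  induction B using Finset.induction_on with
  | empty => exact SameC.refl _
  | insert k B hk ih =>
    have hcard := Finset.card_insert_of_notMem hk
    have e := sameC_erase (Finset.mem_insert_self k B) (m := m) hB (by omega) h2 w
    simp only [Finset.erase_insert hk] at e
    exact e.trans (ih (by omega) (by omega) (by omega))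

/-! ### Changing the initial values, and the absence of common knowledge -/

/-- Silence `k`, change its value unnoticed, then undo the crash. The bounds are those of
`sameC_erase` for a single silent agent. -/
lemma sameC_update {m : ℕ} (h1 : m + 1 ≤ t) (h2 : m + 3 ≤ n) (w w' : Fin n → Value) (k : Fin n)
    (hw : ∀ j ≠ k, w j = w' j) :
    SameC (silentRun (t := t) ∅ (by simp) w, m + 1) (silentRun (t := t) ∅ (by simp) w', m + 1) := by
  have hB : ({k} : Finset (Fin n)).card ≤ t := by simp; omega
  have e : ∀ w, _ := fun w => sameC_silentRun_empty (m := m) w {k} hB (by simp; omega)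
    (by simp; omega)
  refine (e w).symm.trans (SameC.trans ?_ (e w'))
  have : Nontrivial (Fin n) := Fin.nontrivial_iff_two_le.2 (by omega)
  obtain ⟨i, hi⟩ := exists_ne k
  have hi' : i ∉ ({k} : Finset (Fin n)) := by simpa using hi
  refine (silentRun_nonfailed hi').sameC_silentRun hB (fun x => (silentRun_reach hi').symm) ?_
  exact fun j hj => hw j (by simpa using hj)

lemma sameC_init {p : (Fin n → Value) → Point n t}
    (h : ∀ w w' k, (∀ j ≠ k, w j = w' j) → SameC (p w) (p w')) (w w' : Fin n → Value) :
    SameC (p w) (p w') := by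
  classical
  have : ∀ S : Finset (Fin n), SameC (p w) (p fun j => if j ∈ S then w' j else w j) := by
    intro S
    induction S using Finset.induction_on with
    | empty => simpa using SameC.refl _
    | insert k S _ ih =>
      refine ih.trans (h _ _ k fun j hj => ?_)
      simp [Finset.mem_insert, hj]
  simpa using this Finset.univ

/-- Common knowledge would carry over to the run in which every initial value is the other one. -/
lemma not_C_existsValue_of_sameC {p : (Fin n → Value) → Run n t} {m : ℕ} (ht : t < n)
    (hp : ∀ w, (p w).init = w)
    (h : ∀ w w' k, (∀ j ≠ k, w j = w' j) → SameC (p w, m) (p w', m)) (w : Fin n → Value)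
    (v : Value) : ¬ C (existsValue v) (p w, m) := by
  intro hC
  obtain ⟨v', hv'⟩ : ∃ v' : Value, v' ≠ v := exists_ne v
  rw [sameC_init (p := fun w => (p w, m)) h w (fun _ => v') _] at hC
  obtain ⟨i, hi⟩ := (p fun _ => v').exists_nonfailed ht m
  obtain ⟨k, hk⟩ := hC.apply_of_nonfailed hi (rfl : Indist i _ _)
  rw [hp] at hk
  exact hv' hk

lemma not_C_existsValue_zero (ht : t < n) (h2 : 2 ≤ n) (r : Run n t) (v : Value) :
    ¬ C (existsValue v) (r, 0) := by
  refine not_C_existsValue_of_sameC (p := fun w => { r with init := w }) ht (fun _ => rfl)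
    (fun w w' k hw => ?_) r.init v
  have : Nontrivial (Fin n) := Fin.nontrivial_iff_two_le.2 h2
  obtain ⟨i, hi⟩ := exists_ne k
  refine sameC_of_indist (i := i) (Run.nonfailed_zero _ i) ?_
  simp [Indist, Run.state, hw i hi]

/-- Failure of the condition says that `max 1 β + m ≤ t` and `max 1 β + m + 2 ≤ n`. The bounds with
`β` pay for removing the silent crashes, those with `1` for changing an initial value. -/
lemma not_C_existsValue_succ (ht : t < n) {m : ℕ} {r : Run n t} {i : Fin n}
    (h : r.Nonfailed (m + 1) i) (hs : ¬ StopCond n t (m + 1) (r.beta (m + 1) i)) (v : Value) :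
    ¬ C (existsValue v) (r, m + 1) := by
  classical
  rw [StopCond, h.beta_eq] at hs
  set B := Finset.univ.filter fun k => ¬ r.Reach (m + 1) i k with hBdef
  have hB : B.card ≤ t := by omega
  have e := h.sameC_silentRun hB (w := r.init) (fun k => by simp [hBdef]) fun _ _ => rfl
  have e' := e.trans (sameC_silentRun_empty (m := m) r.init B hB (by omega) (by omega))
  rw [e']
  exact not_C_existsValue_of_sameC (p := fun w => silentRun (t := t) ∅ (by simp) w) ht
    (fun _ => rfl) (fun w w' k hw => sameC_update (by omega) (by omega) w w' k hw) r.init v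

lemma guard_and_stopCond_of_C (ht : t < n) {r : Run n t} {m : ℕ} {i : Fin n}
    (h : r.Nonfailed m i) {v : Value} (hC : C (existsValue v) (r, m)) :
    (0 < m ∨ n ≤ t + 2) ∧ StopCond n t m (r.beta m i) := by
  cases m with
  | zero =>
    have h2 : ¬ 2 ≤ n := fun h2 => not_C_existsValue_zero ht h2 r v hC
    rw [Run.Nonfailed.beta_zero, StopCond]
    omega
  | succ m =>
    refine ⟨Or.inl (Nat.succ_pos m), ?_⟩
    by_contra hs
    exact not_C_existsValue_succ ht h hs v hC

/-! ### The early-stopping rule -/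

open Classical in
lemma decides_stopRule_iff {r : Run n t} {m : ℕ} {i : Fin n} {v : Value} :
    Decides (stopRule n t) r m i v ↔ r.Nonfailed m i ∧
      ((0 < m ∨ n ≤ t + 2) ∧ StopCond n t m (r.beta m i)) ∧
      v = if ∃ k, r.vec m i k = some 0 then 0 else 1 := by
  refine and_congr_right fun h => ?_
  rw [h.state_eq, h.beta_eq_vec, stopRule]
  split_ifs <;> simp_all [eq_comm]

lemma exists_decides_stopRule_iff {r : Run n t} {m : ℕ} {i : Fin n} :
    (∃ v, Decides (stopRule n t) r m i v) ↔ r.Nonfailed m i ∧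
      ((0 < m ∨ n ≤ t + 2) ∧ StopCond n t m (r.beta m i)) := by
  classical
  simp only [decides_stopRule_iff]
  exact ⟨fun ⟨_, h⟩ => ⟨h.1, h.2.1⟩, fun h => ⟨_, h.1, h.2, rfl⟩⟩

lemma stopRule_agreement_of_le {r : Run n t} {m m' : ℕ} {i j : Fin n} {v v' : Value}
    (hm : m ≤ m') (h : Decides (stopRule n t) r m i v) (h' : Decides (stopRule n t) r m' j v') :
    v = v' := by
  classical
  rw [decides_stopRule_iff] at h h'
  have hu := h.1.uniform h.2.1.1 h.2.1.2
  have hv : r.vec m i = r.vec m' j := by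
    funext k
    have := hu.reach_iff hm h.1 h'.1 (k := k)
    by_cases hk : r.Reach m i k <;> simp [Run.vec, this, hk]
  rw [h.2.2, h'.2.2, hv]

lemma isSBA_stopRule : IsSBA t (stopRule n t) where
  agreement r m m' i j v v' h h' := by
    rcases le_total m m' with hm | hm
    · exact stopRule_agreement_of_le hm h h'
    · exact (stopRule_agreement_of_le hm h' h).symm
  validity r m i v h := by
    classical
    rw [decides_stopRule_iff] at h
    obtain ⟨hi, -, rfl⟩ := h
    split_ifs with h0
    · obtain ⟨k, hk⟩ := h0
      exact ⟨k, (r.vec_eq_some_iff.1 hk).2⟩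
    · refine ⟨i, ?_⟩
      have h01 : ∀ v : Value, v ≠ 0 → v = 1 := by decide
      exact h01 _ fun hv => h0 ⟨i, r.vec_eq_some_iff.2 ⟨hi.reach_self, hv⟩⟩
  simultaneity r m i v h j hj := by
    obtain ⟨hi, hg, hs⟩ := exists_decides_stopRule_iff.1 ⟨v, h⟩
    refine exists_decides_stopRule_iff.2 ⟨hj, hg, ?_⟩
    rwa [← hi.beta_congr hj ((hi.uniform hg hs).vec_eq hi hj)]

/-- "Somebody decides `v` now" is invariant: simultaneity makes every survivor decide, agreement
fixes the value, and the action depends on the local state alone. -/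
lemma IsSBA.common {P : DecisionProtocol n} (hP : IsSBA t P) {r : Run n t} {m : ℕ} {i : Fin n}
    {v : Value} (h : Decides P r m i v) : C (existsValue v) (r, m) := by
  refine C.of_invariant (ψ := fun p => ∃ j, Decides P p.1 p.2 j v) ?_ ?_ ⟨i, h⟩
  · rintro p ⟨j, hj⟩
    exact hP.validity _ _ _ _ hj
  · rintro p a q ⟨j, hj⟩ ha hq
    obtain ⟨w, hw⟩ := hP.simultaneity _ _ _ _ hj a ha
    obtain rfl := hP.agreement _ _ _ _ _ _ _ hj hw
    refine ⟨a, hq.nonfailed ha, ?_⟩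
    rw [← show p.1.state p.2 a = q.1.state q.2 a from hq]
    exact hw.2

lemma isOptimumSBA_stopRule (ht : t < n) : IsOptimumSBA t (stopRule n t) :=
  ⟨isSBA_stopRule, fun _ hP _ _ _ _ h =>
    exists_decides_stopRule_iff.2 ⟨h.1, guard_and_stopCond_of_C ht h.1 (hP.common h)⟩⟩

lemma silentRun_beta {B : Finset (Fin n)} (hB : B.card ≤ t) (w : Fin n → Value) {m : ℕ}
    {i : Fin n} (hi : i ∉ B) : (silentRun B hB w).beta (m + 1) i = B.card := by
  classical
  rw [(silentRun_nonfailed hi).beta_eq]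
  congr 1
  ext k
  simp [silentRun_reach hi]

lemma exists_early_decision (ht : t < n) (h : 2 ≤ t ∨ n = t + 1) :
    ∃ (r : Run n t) (m : ℕ) (i : Fin n) (v : Value),
      m < t + 1 ∧ Decides (stopRule n t) r m i v := by
  rcases h with h | h
  -- With `t` silent crashes in round 1, `β = t` and the condition holds at time 2.
  · obtain ⟨B, -, hB⟩ := Finset.exists_subset_card_eq (s := (Finset.univ : Finset (Fin n)))
      (n := t) (by simpa using ht.le)
    obtain ⟨i, hi⟩ : ∃ i, i ∉ B := by
      by_contra! hall
      have := Finset.card_le_card (fun i _ => hall i : (Finset.univ : Finset (Fin n)) ⊆ B)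
      simp at this
      omega
    obtain ⟨v, hv⟩ := exists_decides_stopRule_iff.2
      ⟨silentRun_nonfailed (hB := hB.le) (w := 0) (m := 2) hi, Or.inl two_pos, by
        rw [silentRun_beta hB.le 0 hi, StopCond]
        omega⟩
    exact ⟨_, 2, i, v, by omega, hv⟩
  -- Here the minimum is `n - 1 = t`, so time `t` suffices whatever `β` is.
  · have hi : (⟨0, by omega⟩ : Fin n) ∉ (∅ : Finset (Fin n)) := by simp
    obtain ⟨v, hv⟩ := exists_decides_stopRule_iff.2
      ⟨silentRun_nonfailed (hB := Nat.zero_le t) (w := 0) (m := t) hi, Or.inr (by omega), by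
        rw [StopCond]
        omega⟩
    exact ⟨_, t, _, v, by omega, hv⟩

end VecFloodSet

theorem mainTheorem7 (n t : ℕ) (ht : t < n) :
    -- characterization of common knowledge
    (∀ (r : VecFloodSet.Run n t) (m : ℕ) (i : Fin n), r.Nonfailed m i → (0 < m ∨ n ≤ t + 2) →
      ((VecFloodSet.C (VecFloodSet.existsValue 0) (r, m) ∨
          VecFloodSet.C (VecFloodSet.existsValue 1) (r, m)) ↔
        (m : ℤ) > min ((t : ℤ) + 1) ((n : ℤ) - 1) - max 1 (r.beta m i : ℤ))) ∧
    -- the resulting early-stopping rule is an optimum SBA protocol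
    VecFloodSet.IsOptimumSBA t (VecFloodSet.stopRule n t) ∧
    -- it never decides later than time t + 1
    (∀ (r : VecFloodSet.Run n t) (i : Fin n), r.Nonfailed (t + 1) i →
      ∃ m ≤ t + 1, ∃ v, VecFloodSet.Decides (VecFloodSet.stopRule n t) r m i v) ∧
    -- and it sometimes decides strictly earlier
    ((2 ≤ t ∨ n = t + 1) → ∃ (r : VecFloodSet.Run n t) (m : ℕ) (i : Fin n) (v : Fin 2),
      m < t + 1 ∧ VecFloodSet.Decides (VecFloodSet.stopRule n t) r m i v) := by
  refine ⟨fun r m i hi hg => ⟨?_, fun hs => ?_⟩, VecFloodSet.isOptimumSBA_stopRule ht,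
    fun r i hi => ?_, VecFloodSet.exists_early_decision ht⟩
  · rintro (hC | hC)
    · exact (VecFloodSet.guard_and_stopCond_of_C ht hi hC).2
    · exact (VecFloodSet.guard_and_stopCond_of_C ht hi hC).2
  · have hC := hi.common hg hs
    have h01 : ∀ v : VecFloodSet.Value, v = 0 ∨ v = 1 := by decide
    rcases h01 (r.init i) with h | h <;> rw [h] at hC
    · exact Or.inl hC
    · exact Or.inr hC
  · refine ⟨t + 1, le_rfl, VecFloodSet.exists_decides_stopRule_iff.2
      ⟨hi, Or.inl (Nat.succ_pos t), ?_⟩⟩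
    rw [VecFloodSet.StopCond]
    push_cast
    omega
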